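/- Let $p$ be a prime and let $G$ be a finite $p$-group of nilpotency class $c$. Define the integers $r,s\ge 0$ by $\exp(G/G')=p^r$ and $\exp(Z(G))=p^s$, where $G'=\gamma_2(G)$ is the derived subgroup and $Z(G)$ is the centre of $G$, and put $t=\min\{r,s\}$. Let $P(G)=\gamma_2(G)G^p$ if $p>2$ and $P(G)=\gamma_2(G)G^4$ if $p=2$, where $G^n$ denotes the subgroup generated by all $n$-th powers of elements of $G$. Let $\mathrm{Aut}_{P(G)}(G)$ be the group of all automorphisms $u$ of $G$ such that $x^{-1}u(x)\in P(G)$ for all $x\in G$. Then $$\exp\bigl(\mathrm{Aut}_{P(G)}(G)\bigr)\le p^{t^2c-t}.$$ Moreover, if $G$ can be generated by $d\ge 1$ elements, then every $p$-subgroup $P$ of $\mathrm{Aut}(G)$ satisfies $\exp(P)\le p^{t^2c-t+d-1}$ if $p>2$, and $\exp(P)\le p^{t^2c-t+2d-1}$ if $p=2$. -/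

import Mathlib

/-- The subgroup `P(G)` of a group `G`: it is `γ₂(G) G ^ 4` if `p = 2` and `γ₂(G) G ^ p`
otherwise, where `G ^ n` is the subgroup generated by the `n`-th powers of elements of `G`. -/
def powerDerivedSubgroup (p : ℕ) (G : Type*) [Group G] : Subgroup G :=
  commutator G ⊔ Subgroup.closure (Set.range fun x : G => x ^ (if p = 2 then 4 else p))

/-- `Aut_N(G)` for a subgroup `N` of `G`: the group of automorphisms `u` of `G` such that
`x⁻¹ u(x) ∈ N` for all `x ∈ G`. -/
def autTrivialMod {G : Type*} [Group G] (N : Subgroup G) : Subgroup (MulAut G) where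
  carrier := {u | ∀ x : G, x⁻¹ * u x ∈ N}
  one_mem' := fun x => by simp
  mul_mem' := by
    intro u v hu hv x
    have h := N.mul_mem (hv x) (hu (v x))
    simpa [mul_assoc] using h
  inv_mem' := by
    intro u hu x
    have h := N.inv_mem (hu (u⁻¹ x))
    simpa using h

/-! ### The subgroup γ₂(G)Gᵖ. -/

open scoped commutatorElement

/-! For every `p`, including 2, an automorphism trivial modulo γ₂(G)Gᵖ is killed by p^(tc-1), which
suffices since tc-1 ≤ t(tc-1) = t²c-t. The proof is by induction on the class through G/Z(G)
(`pow_eq_one_of_mem_autTrivialMod`). If w is trivial modulo the centre, x ↦ x⁻¹w(x) is a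
homomorphism G/G' → Z(G), so its values have order dividing both exponents, hence p^t; by
`exists_pow_apply_eq` raising w to the power p^t raises such values to the power p^t. So each unit
of class costs a factor p^t.

For a `p`-subgroup, a `p`-element acts unipotently on the 𝔽_p-space G/γ₂(G)Gᵖ of dimension at most
d, so its p^(d-1)-th power is trivial there and the first part applies. -/

/-- The subgroup `γ₂(G) G ^ p` of a group `G`. -/
def derivedMulPow (p : ℕ) (G : Type*) [Group G] : Subgroup G :=
  commutator G ⊔ Subgroup.closure (Set.range fun x : G => x ^ p)

theorem pow_mem_derivedMulPow (p : ℕ) {G : Type*} [Group G] (x : G) :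
    x ^ p ∈ derivedMulPow p G :=
  (le_sup_right : _ ≤ derivedMulPow p G) (Subgroup.subset_closure ⟨x, rfl⟩)

theorem commutator_le_derivedMulPow (p : ℕ) (G : Type*) [Group G] :
    commutator G ≤ derivedMulPow p G := le_sup_left

instance derivedMulPow_normal (p : ℕ) (G : Type*) [Group G] : (derivedMulPow p G).Normal :=
  Subgroup.Normal.of_commutator_le _ (commutator_le_derivedMulPow p G)

theorem derivedMulPow_le_iff {p : ℕ} {G : Type*} [Group G] {H : Subgroup G} :
    derivedMulPow p G ≤ H ↔ commutator G ≤ H ∧ ∀ x : G, x ^ p ∈ H := by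
  simp [derivedMulPow, Set.range_subset_iff]

theorem powerDerivedSubgroup_le_derivedMulPow (p : ℕ) (G : Type*) [Group G] :
    powerDerivedSubgroup p G ≤ derivedMulPow p G := by
  refine sup_le (commutator_le_derivedMulPow p G) ?_
  rw [Subgroup.closure_le]
  rintro _ ⟨x, rfl⟩
  dsimp only
  split_ifs with h
  · subst h
    rw [show 4 = 2 * 2 from rfl, pow_mul]
    exact pow_mem_derivedMulPow 2 _
  · exact pow_mem_derivedMulPow p x

theorem map_mem_commutator {G H : Type*} [Group G] [Group H] (f : G →* H) {x : G}
    (hx : x ∈ commutator G) : f x ∈ commutator H := by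
  have h : commutator G ≤ (commutator H).comap f := by
    rw [commutator_def G, Subgroup.commutator_le]
    intro a _ b _
    rw [Subgroup.mem_comap, map_commutatorElement, commutator_def H]
    exact Subgroup.commutator_mem_commutator trivial trivial
  exact h hx

theorem map_mem_derivedMulPow {p : ℕ} {G H : Type*} [Group G] [Group H] (f : G →* H) {x : G}
    (hx : x ∈ derivedMulPow p G) : f x ∈ derivedMulPow p H := by
  have h : derivedMulPow p G ≤ (derivedMulPow p H).comap f := by
    rw [derivedMulPow_le_iff]
    refine ⟨fun y hy => commutator_le_derivedMulPow p H (map_mem_commutator f hy), fun y => ?_⟩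
    rw [Subgroup.mem_comap, map_pow]
    exact pow_mem_derivedMulPow p _
  exact h hx

theorem autTrivialMod_mono {G : Type*} [Group G] {N M : Subgroup G} (h : N ≤ M) :
    autTrivialMod N ≤ autTrivialMod M := fun _ hu x => h (hu x)

/-! ### Powers of central automorphisms. -/

/-- The homomorphism `x ↦ x⁻¹ w(x)` attached to a central automorphism `w`. -/
def centralDisplacement {G : Type*} [Group G] (w : MulAut G)
    (hw : ∀ x, x⁻¹ * w x ∈ Subgroup.center G) : G →* G where
  toFun x := x⁻¹ * w x
  map_one' := by simp
  map_mul' x y := by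
    have h := Subgroup.mem_center_iff.1 (hw x) y⁻¹
    rw [map_mul, mul_inv_rev, show y⁻¹ * x⁻¹ * (w x * w y) = y⁻¹ * (x⁻¹ * w x) * w y by group, h]
    group

theorem commutator_le_ker_of_central {G : Type*} [Group G] (f : G →* G)
    (hf : ∀ x, f x ∈ Subgroup.center G) : commutator G ≤ f.ker := by
  rw [commutator_def, Subgroup.commutator_le]
  intro a _ b _
  rw [MonoidHom.mem_ker, map_commutatorElement, commutatorElement_eq_one_iff_mul_comm]
  exact Subgroup.mem_center_iff.1 (hf b) _

/-- If `C` is a central subgroup inside `γ₂(G) G ^ p` and `w` is trivial modulo `C`, then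
`w ^ (p ^ i)` is trivial modulo the `p ^ i`-th powers of elements of `C`. -/
theorem exists_pow_apply_eq {p : ℕ} {G : Type*} [Group G] {C : Subgroup G}
    (hZ : C ≤ Subgroup.center G) (hC : C ≤ derivedMulPow p G) {w : MulAut G}
    (hw : w ∈ autTrivialMod C) (i : ℕ) (x : G) :
    ∃ b ∈ C, (w ^ p ^ i) x = x * b ^ p ^ i := by
  induction i generalizing x with
  | zero => exact ⟨_, hw x, by simp⟩
  | succ i ih =>
    set v := w ^ p ^ i with hv
    have hvC : ∀ x, x⁻¹ * v x ∈ C := fun x => by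
      obtain ⟨b, hb, h⟩ := ih x
      rw [h, inv_mul_cancel_left]
      exact pow_mem hb _
    let f := centralDisplacement v fun x => hZ (hvC x)
    have hfapply : ∀ x, v x = x * f x := fun x => (mul_inv_cancel_left x (v x)).symm
    have comm : ∀ a ∈ C, ∀ g : G, a * g = g * a := fun a ha g =>
      (Subgroup.mem_center_iff.1 (hZ ha) g).symm
    let D : Subgroup G :=
      { carrier := {y | ∃ c ∈ C, y = c ^ p ^ (i + 1)}
        one_mem' := ⟨1, one_mem _, by simp⟩
        mul_mem' := by
          rintro _ _ ⟨a, ha, rfl⟩ ⟨b, hb, rfl⟩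
          exact ⟨a * b, mul_mem ha hb, (Commute.mul_pow (comm a ha b) _).symm⟩
        inv_mem' := by
          rintro _ ⟨a, ha, rfl⟩
          exact ⟨a⁻¹, inv_mem ha, by simp⟩ }
    -- `f` kills commutators and sends y^p to f(y)^p, so `v` fixes `C` modulo `D`.
    have hfD : derivedMulPow p G ≤ D.comap f := by
      rw [derivedMulPow_le_iff]
      refine ⟨fun y hy => ?_, fun y => ?_⟩
      · have h : f y = 1 := commutator_le_ker_of_central f (fun x => hZ (hvC x)) hy
        rw [Subgroup.mem_comap, h]
        exact one_mem _
      · obtain ⟨b, hb, h⟩ := ih y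
        have hfy : f y = b ^ p ^ i := by
          rw [hfapply] at h
          exact mul_left_cancel h
        exact ⟨b, hb, by rw [map_pow, hfy, ← pow_mul, ← pow_succ]⟩
    obtain ⟨b, hb, hxb⟩ := ih x
    -- Modulo `D`, each application of `v` contributes one more factor f(x) = b^(p^i). At n = p the
    -- product of these is itself a p^(i+1)-th power.
    have key : ∀ n : ℕ, ∃ c ∈ D, (v ^ n) x = x * (b ^ p ^ i) ^ n * c := by
      intro n
      induction n with
      | zero => exact ⟨1, one_mem _, by simp⟩
      | succ n ihn =>
        obtain ⟨c, hc, h⟩ := ihn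
        have hcC : c ∈ C := by
          obtain ⟨a, ha, rfl⟩ := hc
          exact pow_mem ha _
        have hβ : (b ^ p ^ i) ^ n ∈ C := pow_mem (pow_mem hb _) _
        refine ⟨f ((b ^ p ^ i) ^ n) * (c * f c), mul_mem (hfD (hC hβ))
          (mul_mem hc (hfD (hC hcC))), ?_⟩
        have h2 := comm _ hβ (b ^ p ^ i)
        rw [pow_succ', MulAut.mul_apply, h, map_mul, map_mul, hxb, hfapply c,
          hfapply ((b ^ p ^ i) ^ n), pow_succ, h2]
        simp only [mul_assoc]
    obtain ⟨_, ⟨c, hc, rfl⟩, h⟩ := key p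
    refine ⟨b * c, mul_mem hb hc, ?_⟩
    rw [pow_succ, pow_mul, ← hv, h, Commute.mul_pow (comm b hb c), ← pow_mul, ← pow_succ,
      mul_assoc]

/-! ### Induction on the class. -/

/-- The automorphism of `G ⧸ Z(G)` induced by an automorphism of `G`. -/
def quotientCenterAut {G : Type*} [Group G] (u : MulAut G) : MulAut (G ⧸ Subgroup.center G) :=
  QuotientGroup.congr _ _ u (Subgroup.characteristic_iff_map_eq.1 inferInstance u)

theorem quotientCenterAut_pow_mk {G : Type*} [Group G] (u : MulAut G) (n : ℕ) (x : G) :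
    (quotientCenterAut u ^ n) (x : G ⧸ Subgroup.center G) = ((u ^ n) x : G) := by
  induction n generalizing x with
  | zero => rfl
  | succ n ih =>
    rw [pow_succ, pow_succ, MulAut.mul_apply, MulAut.mul_apply, ← ih]
    rfl

/-- For z in the second centre, ⁅z, g⁆ is central, so conjugating z^n by g only introduces ⁅z,
g⁆^(-n) = 1. -/
theorem pow_center_quotient_center {G : Type*} [Group G] {n : ℕ}
    (h : ∀ z ∈ Subgroup.center G, z ^ n = 1) :
    ∀ z ∈ Subgroup.center (G ⧸ Subgroup.center G), z ^ n = 1 := by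
  intro z hz
  obtain ⟨z, rfl⟩ := QuotientGroup.mk_surjective z
  rw [← QuotientGroup.mk_pow, QuotientGroup.eq_one_iff, Subgroup.mem_center_iff]
  intro g
  have hc : ⁅z, g⁆ ∈ Subgroup.center G := by
    rw [← QuotientGroup.eq_one_iff]
    have := Subgroup.mem_center_iff.1 hz (g : G ⧸ Subgroup.center G)
    change (z : G ⧸ Subgroup.center G) * g * (z : G ⧸ Subgroup.center G)⁻¹ *
      (g : G ⧸ Subgroup.center G)⁻¹ = 1
    rw [← this]
    group
  have hconj : g * z * g⁻¹ = ⁅z, g⁆⁻¹ * z := by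
    rw [commutatorElement_def]
    group
  have hpow : g * z ^ n * g⁻¹ = z ^ n := by
    have hcomm : Commute ⁅z, g⁆⁻¹ z :=
      (Subgroup.mem_center_iff.1 (inv_mem hc) z).symm
    rw [← conj_pow, hconj, hcomm.mul_pow, inv_pow, h _ hc, inv_one, one_mul]
  exact mul_inv_eq_iff_eq_mul.1 hpow

/-- An automorphism `u` of a nilpotent group `G` of class at most `c`, trivial modulo
`γ₂(G) G ^ p`, satisfies `u ^ (p ^ (k c - 1)) = 1` as soon as `G / γ₂(G)` or `Z(G)` has exponent
dividing `p ^ k`. -/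
theorem pow_eq_one_of_mem_autTrivialMod {p k : ℕ} (hk : 1 ≤ k) (c : ℕ) (hc : 1 ≤ c)
    {G : Type*} [Group G] [Group.IsNilpotent G] (hcl : Group.nilpotencyClass G ≤ c)
    (h : (∀ x : G, x ^ p ^ k ∈ commutator G) ∨ ∀ z ∈ Subgroup.center G, z ^ p ^ k = 1)
    {u : MulAut G} (hu : u ∈ autTrivialMod (derivedMulPow p G)) :
    u ^ p ^ (k * c - 1) = 1 := by
  induction c, hc using Nat.le_induction generalizing G with
  | base =>
    have hab : Subgroup.center G = ⊤ := by
      rw [← Subgroup.upperCentralSeries_one]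
      exact Subgroup.upperCentralSeries_eq_top_iff_nilpotencyClass_le.2 hcl
    have hcomm : commutator G = ⊥ := by
      rw [commutator_def, Subgroup.commutator_top_left_eq_bot_iff_le_center]
      exact hab.ge
    have hexp : ∀ x : G, x ^ p ^ k = 1 := by
      rcases h with h | h
      · simpa [hcomm] using h
      · simpa [hab] using h
    have hmc : ∀ x y : G, x * y = y * x := fun x y =>
      (Subgroup.mem_center_iff.1 (hab ▸ Subgroup.mem_top x) y).symm
    -- In the abelian case displacements are already p-th powers; this saves the factor p behind the
    -- -1 in the exponent.
    have hpow : ∀ b ∈ derivedMulPow p G, b ^ p ^ (k - 1) = 1 := by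
      let K : Subgroup G :=
        { carrier := {y | y ^ p ^ (k - 1) = 1}
          one_mem' := one_pow _
          mul_mem' := fun {a b} ha hb => by
            have ha : a ^ p ^ (k - 1) = 1 := ha
            have hb : b ^ p ^ (k - 1) = 1 := hb
            change (a * b) ^ p ^ (k - 1) = 1
            rw [Commute.mul_pow (hmc a b), ha, hb, one_mul]
          inv_mem' := fun {a} ha => by
            have ha : a ^ p ^ (k - 1) = 1 := ha
            change a⁻¹ ^ p ^ (k - 1) = 1
            rw [inv_pow, ha, inv_one] }
      have hK : derivedMulPow p G ≤ K := by
        rw [derivedMulPow_le_iff, hcomm]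
        refine ⟨bot_le, fun x => ?_⟩
        change (x ^ p) ^ p ^ (k - 1) = 1
        rw [← pow_mul, ← pow_succ', Nat.sub_add_cancel hk, hexp]
      exact fun b hb => hK hb
    ext x
    obtain ⟨b, hb, hx⟩ := exists_pow_apply_eq (hab ▸ le_top) le_rfl hu (k - 1) x
    rw [mul_one, hx, hpow b hb, mul_one, MulAut.one_apply]
  | succ c hc ih =>
    set w := u ^ p ^ (k * c - 1) with hw
    have hq : quotientCenterAut u ^ p ^ (k * c - 1) = 1 := by
      refine ih ?_ ?_ ?_
      · rw [Group.nilpotencyClass_quotient_center]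
        omega
      · refine h.imp (fun h x => ?_) pow_center_quotient_center
        obtain ⟨x, rfl⟩ := QuotientGroup.mk_surjective x
        exact map_mem_commutator (QuotientGroup.mk' (Subgroup.center G)) (h x)
      · intro x
        obtain ⟨x, rfl⟩ := QuotientGroup.mk_surjective x
        exact map_mem_derivedMulPow (QuotientGroup.mk' (Subgroup.center G)) (hu x)
    have hwZ : ∀ x, x⁻¹ * w x ∈ Subgroup.center G := fun x => by
      rw [← QuotientGroup.eq, ← quotientCenterAut_pow_mk, hq, MulAut.one_apply]
    have hwP : w ∈ autTrivialMod (derivedMulPow p G) := pow_mem hu _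
    let f := centralDisplacement w hwZ
    -- Either exponent suffices: `f` factors through G/G' and takes values in Z(G).
    have hexp : ∀ x, f x ^ p ^ k = 1 := fun x => by
      rcases h with h | h
      · rw [← map_pow]
        exact commutator_le_ker_of_central f hwZ (h x)
      · exact h _ (hwZ x)
    ext x
    obtain ⟨_, ⟨y, rfl⟩, hx⟩ := exists_pow_apply_eq (p := p) (C := f.range) (w := w)
      (by rintro _ ⟨y, rfl⟩; exact hwZ y) (by rintro _ ⟨y, rfl⟩; exact hwP y)
      (fun x => ⟨x, rfl⟩) k x
    have hsum : k * (c + 1) - 1 = (k * c - 1) + k := by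
      have := Nat.mul_le_mul hk hc
      rw [mul_add]
      omega
    rw [hsum, pow_add, pow_mul, ← hw, hx, hexp, mul_one, MulAut.one_apply]

/-! ### Action on the elementary abelian quotient. -/

/-- A unipotent endomorphism of a `d`-generated vector space over `𝔽_p` has order dividing
`p ^ (d - 1)`. -/
theorem linear_pow_eq_one_of_pow_eq_one {p : ℕ} [Fact p.Prime] {V : Type*} [AddCommGroup V]
    [Module (ZMod p) V] {d : ℕ} (hd : 1 ≤ d) (g : Fin d → V)
    (hg : Submodule.span (ZMod p) (Set.range g) = ⊤) (φ : Module.End (ZMod p) V) (m : ℕ)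
    (hφ : φ ^ p ^ m = 1) : φ ^ p ^ (d - 1) = 1 := by
  have hfin : Module.Finite (ZMod p) V := 
    ⟨hg ▸ Submodule.fg_span (Set.finite_range g)⟩
  have hrank : Module.finrank (ZMod p) V ≤ d := by
    simpa using finrank_le_of_span_eq_top hg
  -- Frobenius makes φ - 1 nilpotent; Cayley–Hamilton then bounds its index by the dimension, and d
  -- ≤ p^(d-1).
  have hfrob : ∀ n, (φ - 1) ^ p ^ n = φ ^ p ^ n - 1 := fun n => by
    have h : ((Polynomial.X - 1) ^ p ^ n : Polynomial (ZMod p)) = Polynomial.X ^ p ^ n - 1 := by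
      rw [sub_pow_char_pow, one_pow]
    simpa using congrArg (Polynomial.aeval φ) h
  have hnil : IsNilpotent (φ - 1) := ⟨p ^ m, by rw [hfrob, hφ, sub_self]⟩
  have hpow : (φ - 1) ^ Module.finrank (ZMod p) V = 0 := by
    simpa [hnil.charpoly_eq_X_pow_finrank] using (φ - 1).aeval_self_charpoly
  have hle : Module.finrank (ZMod p) V ≤ p ^ (d - 1) := by
    have := Nat.lt_pow_self (Fact.out : p.Prime).one_lt (n := d - 1)
    omega
  rw [← sub_eq_zero, ← hfrob, ← Nat.sub_add_cancel hle, pow_add, hpow, mul_zero]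

/-- An endomorphism of `p`-power order of a `d`-generated elementary abelian `p`-group has order
dividing `p ^ (d - 1)`. -/
theorem iterate_eq_of_iterate_eq {p : ℕ} [Fact p.Prime] {V : Type*} [AddCommGroup V]
    (hV : ∀ x : V, p • x = 0) {d : ℕ} (hd : 1 ≤ d) (g : Fin d → V)
    (hg : AddSubgroup.closure (Set.range g) = ⊤) (φ : V →+ V) {m : ℕ}
    (hφ : ∀ x, φ^[p ^ m] x = x) (x : V) : φ^[p ^ (d - 1)] x = x := by
  obtain ⟨_⟩ : Nonempty (Module (ZMod p) V) := ⟨AddCommGroup.zmodModule hV⟩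
  let ψ : Module.End (ZMod p) V := AddMonoidHom.toZModLinearMap p φ
  have hspan : Submodule.span (ZMod p) (Set.range g) = ⊤ := by
    have h : AddSubgroup.closure (Set.range g) ≤
        (Submodule.span (ZMod p) (Set.range g)).toAddSubgroup := by
      rw [AddSubgroup.closure_le]
      exact Submodule.subset_span
    rw [Submodule.eq_top_iff']
    exact fun x => h (hg ▸ AddSubgroup.mem_top x)
  have h := linear_pow_eq_one_of_pow_eq_one hd g hspan ψ m (by
    ext x
    rw [Module.End.pow_apply]
    exact hφ x)
  have hx := LinearMap.congr_fun h x
  rwa [Module.End.pow_apply] at hx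

/-- In a `d`-generated group, the `p ^ (d - 1)`-th power of an automorphism of `p`-power order is
trivial modulo `γ₂(G) G ^ p`. -/
theorem pow_mem_autTrivialMod {p : ℕ} [Fact p.Prime] {G : Type*} [Group G] {d : ℕ} (hd : 1 ≤ d)
    (g : Fin d → G) (hg : Subgroup.closure (Set.range g) = ⊤) {u : MulAut G} {m : ℕ}
    (hu : u ^ p ^ m = 1) : u ^ p ^ (d - 1) ∈ autTrivialMod (derivedMulPow p G) := by
  let _ : CommGroup (G ⧸ derivedMulPow p G) :=
    { (inferInstance : Group (G ⧸ derivedMulPow p G)) with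
      mul_comm := fun a b =>
        ((Subgroup.Normal.quotient_commutative_iff_commutator_le (N := derivedMulPow p G)).2
          (commutator_le_derivedMulPow p G)).is_comm.comm a b }
  let φ : G ⧸ derivedMulPow p G →* G ⧸ derivedMulPow p G :=
    QuotientGroup.map (derivedMulPow p G) (derivedMulPow p G) u.toMonoidHom
      fun _ hx => map_mem_derivedMulPow u.toMonoidHom hx
  have hφ : ∀ (n : ℕ) (x : G), φ^[n] (x : G ⧸ derivedMulPow p G) = ((u ^ n) x : G) := by
    intro n
    induction n with
    | zero => exact fun x => rfl
    | succ n ih =>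
      intro x
      rw [pow_succ, MulAut.mul_apply, ← ih]
      rfl
  have hgen : Subgroup.closure (Set.range fun i => (g i : G ⧸ derivedMulPow p G)) = ⊤ := by
    have h := MonoidHom.map_closure (QuotientGroup.mk' (derivedMulPow p G)) (Set.range g)
    rw [hg, ← Set.range_comp, Subgroup.map_top_of_surjective _
      (QuotientGroup.mk'_surjective _)] at h
    exact h.symm
  have h := iterate_eq_of_iterate_eq (p := p) (V := Additive (G ⧸ derivedMulPow p G)) (m := m)
    (fun x => by
      obtain ⟨x, rfl⟩ := Additive.ofMul.surjective x
      obtain ⟨x, rfl⟩ := QuotientGroup.mk_surjective x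
      exact congrArg Additive.ofMul
        ((QuotientGroup.eq_one_iff _).2 (pow_mem_derivedMulPow p x)))
    hd (fun i => Additive.ofMul (g i : G ⧸ derivedMulPow p G))
    (by
      have h := congrArg Subgroup.toAddSubgroup hgen
      rw [Subgroup.toAddSubgroup_closure] at h
      exact h)
    (MonoidHom.toAdditive φ)
    (fun x => by
      obtain ⟨x, rfl⟩ := Additive.ofMul.surjective x
      obtain ⟨x, rfl⟩ := QuotientGroup.mk_surjective x
      refine (congrArg Additive.ofMul (hφ (p ^ m) x)).trans ?_
      rw [hu]
      rfl)
  intro x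
  rw [← QuotientGroup.eq, ← hφ]
  exact (h (Additive.ofMul (x : G ⧸ derivedMulPow p G))).symm

/-! ### Assembly of the bounds. -/

theorem exponent_le_pow {p : ℕ} (hp : p.Prime) {G : Type*} [Group G] {H : Subgroup G} {m n : ℕ}
    (hmn : m ≤ n) (h : ∀ u ∈ H, u ^ p ^ m = 1) : Monoid.exponent H ≤ p ^ n :=
  Nat.le_of_dvd (pow_pos hp.pos n) ((Monoid.exponent_dvd_of_forall_pow_eq_one fun u =>
    Subtype.ext (h u u.2)).trans (pow_dvd_pow p hmn))

theorem theoremC {p : ℕ} [Fact p.Prime] {G : Type*} [Group G] [Finite G] (hG : IsPGroup p G)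
    (c r s t : ℕ) (hc : Group.nilpotencyClass G = c)
    (hr : Monoid.exponent (G ⧸ commutator G) = p ^ r)
    (hs : Monoid.exponent (Subgroup.center G) = p ^ s)
    (ht : t = min r s) :
    Monoid.exponent (autTrivialMod (powerDerivedSubgroup p G)) ≤ p ^ (t ^ 2 * c - t) ∧
    ∀ d : ℕ, 1 ≤ d → (∃ g : Fin d → G, Subgroup.closure (Set.range g) = ⊤) →
      ∀ P : Subgroup (MulAut G), IsPGroup p P →
        (2 < p → Monoid.exponent P ≤ p ^ (t ^ 2 * c - t + d - 1)) ∧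
        (p = 2 → Monoid.exponent P ≤ p ^ (t ^ 2 * c - t + 2 * d - 1)) := by
  have hp : p.Prime := Fact.out
  -- The trivial group has t = 0, where tc-1 would be meaningless; otherwise c, r, s ≥ 1.
  rcases subsingleton_or_nontrivial G with hsub | hnt
  · have htriv : ∀ u : MulAut G, u ^ p ^ 0 = 1 := fun u => by
      ext x
      exact Subsingleton.elim _ _
    exact ⟨exponent_le_pow hp (Nat.zero_le _) fun u _ => htriv u, fun d _ _ P _ =>
      ⟨fun _ => exponent_le_pow hp (Nat.zero_le _) fun u _ => htriv u,
        fun _ => exponent_le_pow hp (Nat.zero_le _) fun u _ => htriv u⟩⟩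
  have hnil : Group.IsNilpotent G := hG.isNilpotent
  have hc1 : 1 ≤ c := by
    rw [← hc, Nat.one_le_iff_ne_zero, Ne, Group.nilpotencyClass_zero_iff_subsingleton]
    exact not_subsingleton G
  have hr1 : 1 ≤ r := by
    rw [Nat.one_le_iff_ne_zero]
    rintro rfl
    rw [pow_zero, Monoid.exp_eq_one_iff, QuotientGroup.subsingleton_iff] at hr
    exact (Group.IsSolvable.commutator_lt_top_of_nontrivial G).ne hr
  have hs1 : 1 ≤ s := by
    rw [Nat.one_le_iff_ne_zero]
    rintro rfl
    rw [pow_zero, Monoid.exp_eq_one_iff] at hs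
    have := hG.center_nontrivial
    exact not_subsingleton (Subgroup.center G) hs
  have ht1 : 1 ≤ t := ht ▸ le_min hr1 hs1
  have hexp : (∀ x : G, x ^ p ^ t ∈ commutator G) ∨ ∀ z ∈ Subgroup.center G, z ^ p ^ t = 1 := by
    rcases le_total r s with h | h
    · left
      intro x
      rw [ht, min_eq_left h, ← hr, ← QuotientGroup.eq_one_iff, QuotientGroup.mk_pow,
        Monoid.pow_exponent_eq_one]
    · right
      intro z hz
      rw [ht, min_eq_right h, ← hs]
      exact congrArg Subtype.val (Monoid.pow_exponent_eq_one (⟨z, hz⟩ : Subgroup.center G))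
  have hmain : ∀ u ∈ autTrivialMod (derivedMulPow p G), u ^ p ^ (t * c - 1) = 1 := fun u hu =>
    pow_eq_one_of_mem_autTrivialMod ht1 c hc1 hc.le hexp hu
  have hle : t * c - 1 ≤ t ^ 2 * c - t := by
    have h : t ^ 2 * c - t = t * (t * c - 1) := by rw [Nat.mul_sub, mul_one, sq, mul_assoc]
    rw [h]
    exact Nat.le_mul_of_pos_left _ ht1
  refine ⟨exponent_le_pow hp hle fun u hu =>
    hmain u (autTrivialMod_mono (powerDerivedSubgroup_le_derivedMulPow p G) hu), ?_⟩
  rintro d hd ⟨g, hg⟩ P hP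
  have hPpow : ∀ u ∈ P, u ^ p ^ (d - 1 + (t * c - 1)) = 1 := fun u hu => by
    obtain ⟨m, hm⟩ := hP ⟨u, hu⟩
    rw [pow_add, pow_mul]
    exact hmain _ (pow_mem_autTrivialMod hd g hg (congrArg Subtype.val hm))
  exact ⟨fun _ => exponent_le_pow hp (by omega) hPpow, fun _ => exponent_le_pow hp (by omega) hPpow⟩
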